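/- Conventions. A fusion category $\mathcal C$ is a $\mathbb C$-linear category (finite-dimensional $\mathrm{Hom}$ spaces, bilinear composition) with a monoidal structure whose tensor product is $\mathbb C$-bilinear, such that every object has a left and a right dual; $\mathcal C$ has finite direct sums; there are finitely many simple objects (objects $s$ with $\mathrm{Hom}(s,s)\simeq\mathbb C$), with only zero morphisms between any two distinct ones, such that every object is a finite direct sum of copies of these; and the tensor unit $\mathbf 1$ is simple. A left dual of $x$ is an object $x^L$ with morphisms $b_x\colon \mathbf 1\to x\otimes x^L$ and $d_x\colon x^L\otimes x\to\mathbf 1$ such that, up to associators and unitors, $(\mathrm{id}_x\otimes d_x)\circ(b_x\otimes \mathrm{id}_x)=\mathrm{id}_x$ and $(d_x\otimes\mathrm{id}_{x^L})\circ(\mathrm{id}_{x^L}\otimes b_x)=\mathrm{id}_{x^L}$. Let $\mathrm{Irr}(\mathcal C)$ be the finite set of isomorphism classes of simple objects. For $x\in\mathcal C$ and $y,z\in\mathrm{Irr}(\mathcal C)$ let $N_{xy}^z\in\mathbb N$ be determined by $x\otimes y\simeq\bigoplus_{z\in\mathrm{Irr}(\mathcal C)}N_{xy}^z\cdot z$,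 where $n\cdot z$ is the direct sum of $n$ copies of $z$, and let $N_x$ be the matrix with entries $(N_x)_{zy}=N_{xy}^z$. The Frobenius–Perron dimension $\mathrm{FPdim}(x)$ is the largest non-negative real eigenvalue of $N_x$. Theorem. Let $\mathcal C$ be a fusion category, let $x\in\mathcal C$ be an object, and let $(x^L,b_x,d_x)$ be a left dual of $x$. Then the following statements are equivalent: (a) The morphisms $b_x\colon \mathbf 1\to x\otimes x^L$ and $d_x\colon x^L\otimes x\to\mathbf 1$ are both isomorphisms. (b) There exists an object $y\in\mathcal C$ such that $x\otimes y\simeq\mathbf 1\simeq y\otimes x$. (c) $\mathrm{FPdim}(x)=1$. -/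

import Mathlib

open CategoryTheory MonoidalCategory Limits

noncomputable section

namespace FusionCat

universe v u

/-- An object `x` of a `ℂ`-linear category is simple if `Hom(x, x) ≃ ℂ` as a vector space. -/
def IsSimple {C : Type u} [Category.{v} C] [Preadditive C] [Linear ℂ C] (x : C) : Prop :=
  Nonempty ((x ⟶ x) ≃ₗ[ℂ] ℂ)

/-- Two objects are disjoint if there are only zero morphisms between them, in both directions. -/
def AreDisjoint {C : Type u} [Category.{v} C] [Preadditive C] (x y : C) : Prop :=
  (∀ f : x ⟶ y, f = 0) ∧ (∀ g : y ⟶ x, g = 0)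

/-- A finite semisimple `ℂ`-linear category: the morphism spaces are finite-dimensional, finite
direct sums exist (the zero object included), and there are finitely many mutually disjoint simple
objects such that every object is a finite direct sum of these (repetitions allowed). -/
class IsFiniteSemisimple (C : Type u) [Category.{v} C] [Preadditive C] [Linear ℂ C] : Prop
    extends HasFiniteBiproducts C where
  finiteDimensional_hom : ∀ x y : C, FiniteDimensional ℂ (x ⟶ y)
  exists_simples : ∃ (n : ℕ) (s : Fin n → C),
    (∀ i, IsSimple (s i)) ∧
    (∀ i j, i ≠ j → AreDisjoint (s i) (s j)) ∧
    ∀ x : C, ∃ (m : ℕ) (k : Fin m → Fin n), Nonempty (x ≅ ⨁ fun l => s (k l))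

/-- A fusion category: a finite semisimple `ℂ`-linear rigid monoidal category with `ℂ`-bilinear
tensor product whose tensor unit is simple. -/
class IsFusion (C : Type u) [Category.{v} C] [Preadditive C] [Linear ℂ C]
    [MonoidalCategory C] [MonoidalPreadditive C] [MonoidalLinear ℂ C] [RigidCategory C] : Prop
    extends IsFiniteSemisimple C where
  isSimple_unit : IsSimple (𝟙_ C)

section Irr

variable (C : Type u) [Category.{v} C] [Preadditive C] [Linear ℂ C]

/-- Isomorphism of simple objects, as an equivalence relation. -/
def simpleSetoid : Setoid {x : C // IsSimple x} where
  r x y := Nonempty (x.1 ≅ y.1)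
  iseqv := ⟨fun x => ⟨Iso.refl x.1⟩, fun ⟨e⟩ => ⟨e.symm⟩, fun ⟨e⟩ ⟨f⟩ => ⟨e ≪≫ f⟩⟩

/-- The type of isomorphism classes of simple objects of `C`. -/
def Irr : Type u := Quotient (simpleSetoid C)

variable {C}

/-- The isomorphism class of a simple object. -/
def Irr.mk (x : C) (hx : IsSimple x) : Irr C := Quotient.mk (simpleSetoid C) ⟨x, hx⟩

/-- A chosen simple object in an isomorphism class. -/
def Irr.rep (z : Irr C) : C := (Quotient.out z).1

theorem Irr.isSimple_rep (z : Irr C) : IsSimple z.rep := (Quotient.out z).2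

theorem Irr.rep_mk_iso (x : C) (hx : IsSimple x) : Nonempty ((Irr.mk x hx).rep ≅ x) :=
  Quotient.exact (s := simpleSetoid C) (Quotient.out_eq (Irr.mk x hx))

theorem IsSimple.id_ne_zero {x : C} (hx : IsSimple x) : 𝟙 x ≠ 0 := by
  obtain ⟨e⟩ := hx
  intro h
  have h1 : e.symm 1 = 0 := by
    rw [← Category.comp_id (e.symm 1), h, comp_zero]
  have h2 : (1 : ℂ) = 0 := by simpa using congrArg e h1
  exact one_ne_zero h2

theorem IsSimple.exists_smul {x : C} (hx : IsSimple x) (f : x ⟶ x) : ∃ c : ℂ, f = c • 𝟙 x := by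
  have hne := hx.id_ne_zero
  obtain ⟨e⟩ := hx
  have h0 : e (𝟙 x) ≠ 0 := fun h => hne (e.injective (by simpa using h))
  refine ⟨e f / e (𝟙 x), e.injective ?_⟩
  simp [h0]

theorem IsSimple.iso_of_comp_ne_zero {x y : C} (hx : IsSimple x) (hy : IsSimple y)
    (f : x ⟶ y) (g : y ⟶ x) (h : f ≫ g ≠ 0) : Nonempty (x ≅ y) := by
  obtain ⟨c, hc⟩ := hx.exists_smul (f ≫ g)
  obtain ⟨d, hd⟩ := hy.exists_smul (g ≫ f)
  have hc0 : c ≠ 0 := by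
    rintro rfl
    exact h (by simpa using hc)
  have hf : f ≠ 0 := by
    rintro rfl
    exact h zero_comp
  have hcd : c • f = d • f := by
    calc c • f = (f ≫ g) ≫ f := by rw [hc, Linear.smul_comp, Category.id_comp]
      _ = f ≫ (g ≫ f) := Category.assoc _ _ _
      _ = d • f := by rw [hd, Linear.comp_smul, Category.comp_id]
  have hcd' : c = d := by
    have h1 : (c - d) • f = 0 := by rw [sub_smul, hcd, sub_self]
    rcases smul_eq_zero.1 h1 with h2 | h2
    · exact sub_eq_zero.1 h2
    · exact absurd h2 hf
  subst hcd'
  exact ⟨⟨f, c⁻¹ • g, by rw [Linear.comp_smul, hc, smul_smul, inv_mul_cancel₀ hc0, one_smul],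
    by rw [Linear.smul_comp, hd, smul_smul, inv_mul_cancel₀ hc0, one_smul]⟩⟩

/-- A simple object that is a finite direct sum of simple objects is isomorphic to a summand. -/
theorem IsSimple.exists_iso_summand {x : C} [HasFiniteBiproducts C] (hx : IsSimple x) {m : ℕ}
    (s : Fin m → C) (hs : ∀ l, IsSimple (s l)) (e : x ≅ ⨁ s) : ∃ l, Nonempty (x ≅ s l) := by
  by_contra! hno
  apply hx.id_ne_zero
  have hz : ∀ l, (e.hom ≫ biproduct.π s l) ≫ (biproduct.ι s l ≫ e.inv) = 0 := fun l => by
    by_contra hl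
    obtain ⟨i⟩ := hx.iso_of_comp_ne_zero (hs l) _ _ hl
    exact (hno l).false i
  calc 𝟙 x = e.hom ≫ 𝟙 (⨁ s) ≫ e.inv := by simp
    _ = ∑ l, (e.hom ≫ biproduct.π s l) ≫ (biproduct.ι s l ≫ e.inv) := by
        rw [← biproduct.total, Preadditive.sum_comp, Preadditive.comp_sum]
        simp
    _ = 0 := by simp [hz]

instance finite_irr [IsFiniteSemisimple C] : Finite (Irr C) := by
  obtain ⟨n, s, hs, -, hdec⟩ := IsFiniteSemisimple.exists_simples (C := C)
  refine Finite.of_surjective (fun i : Fin n => Irr.mk (s i) (hs i)) ?_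
  intro z
  obtain ⟨⟨x, hx⟩, rfl⟩ := Quotient.exists_rep z
  obtain ⟨m, k, ⟨e⟩⟩ := hdec x
  obtain ⟨l, ⟨i⟩⟩ := hx.exists_iso_summand _ (fun l => hs (k l)) e
  exact ⟨k l, Quotient.sound (s := simpleSetoid C) ⟨i.symm⟩⟩

instance fintype_irr [IsFiniteSemisimple C] : Fintype (Irr C) := Fintype.ofFinite _

instance decidableEq_irr : DecidableEq (Irr C) := Classical.decEq _

/-- `n` records a decomposition of `x`: one has `x ≃ ⨁_{z ∈ Irr C} n z · z`, where `n z · z` is the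
direct sum of `n z` copies of `z`. -/
def IsDecomposition [IsFiniteSemisimple C] (x : C) (n : Irr C → ℕ) : Prop :=
  Nonempty (x ≅ ⨁ fun p : (Σ z : Irr C, Fin (n z)) => p.1.rep)

theorem exists_isDecomposition [IsFiniteSemisimple C] (x : C) :
    ∃ n : Irr C → ℕ, IsDecomposition x n := by
  obtain ⟨N, s, hs, -, hdec⟩ := IsFiniteSemisimple.exists_simples (C := C)
  obtain ⟨m, k, ⟨e⟩⟩ := hdec x
  let c : Fin m → Irr C := fun l => Irr.mk (s (k l)) (hs (k l))
  let n : Irr C → ℕ := fun z => Fintype.card {l // c l = z}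
  let E : Fin m ≃ Σ z : Irr C, Fin (n z) :=
    (Equiv.sigmaFiberEquiv c).symm.trans
      (Equiv.sigmaCongrRight fun z => Fintype.equivFin {l // c l = z})
  refine ⟨n, ⟨e ≪≫ biproduct.whiskerEquiv E fun l => ?_⟩⟩
  exact (Irr.rep_mk_iso (s (k l)) (hs (k l))).some

theorem Irr.areDisjoint [IsFiniteSemisimple C] {z w : Irr C} (h : z ≠ w) (f : z.rep ⟶ w.rep) :
    f = 0 := by
  obtain ⟨n, s, hs, hd, hdec⟩ := IsFiniteSemisimple.exists_simples (C := C)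
  obtain ⟨m, k, ⟨e⟩⟩ := hdec z.rep
  obtain ⟨m', k', ⟨e'⟩⟩ := hdec w.rep
  obtain ⟨l, ⟨i⟩⟩ := z.isSimple_rep.exists_iso_summand _ (fun l => hs (k l)) e
  obtain ⟨l', ⟨i'⟩⟩ := w.isSimple_rep.exists_iso_summand _ (fun l => hs (k' l)) e'
  by_cases hk : k l = k' l'
  · exfalso
    apply h
    rw [← Quotient.out_eq z, ← Quotient.out_eq w]
    exact Quotient.sound (s := simpleSetoid C) ⟨i ≪≫ eqToIso (by rw [hk]) ≪≫ i'.symm⟩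
  · have := (hd _ _ hk).1 (i.inv ≫ f ≫ i'.hom)
    calc f = i.hom ≫ (i.inv ≫ f ≫ i'.hom) ≫ i'.inv := by simp
      _ = 0 := by rw [this]; simp

theorem IsDecomposition.eq_finrank [IsFiniteSemisimple C] {x : C} {n : Irr C → ℕ}
    (h : IsDecomposition x n) (z : Irr C) : n z = Module.finrank ℂ (x ⟶ z.rep) := by
  obtain ⟨e⟩ := h
  let L : (x ⟶ z.rep) ≃ₗ[ℂ] (∀ p : (Σ w : Irr C, Fin (n w)), p.1.rep ⟶ z.rep) :=
    { toFun := fun f p => biproduct.ι (fun p : (Σ w : Irr C, Fin (n w)) => p.1.rep) p ≫ e.inv ≫ f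
      invFun := fun g => e.hom ≫ biproduct.desc g
      map_add' := fun f g => by ext p; simp
      map_smul' := fun c f => by ext p; simp
      left_inv := fun f => by
        rw [← cancel_epi e.inv]
        ext p
        simp
      right_inv := fun g => by ext p; simp }
  have : ∀ y w : C, FiniteDimensional ℂ (y ⟶ w) := IsFiniteSemisimple.finiteDimensional_hom
  rw [L.finrank_eq, Module.finrank_pi_fintype, Fintype.sum_sigma, Finset.sum_eq_single z]
  · obtain ⟨E⟩ := z.isSimple_rep
    simp [E.finrank_eq]
  · intro w _ hw
    have : Subsingleton (w.rep ⟶ z.rep) :=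
      ⟨fun f g => by rw [Irr.areDisjoint hw f, Irr.areDisjoint hw g]⟩
    simp [Module.finrank_zero_of_subsingleton]
  · simp

/-- The multiplicities in a decomposition into simple objects do not depend on the decomposition. -/
theorem IsDecomposition.unique [IsFiniteSemisimple C] {x : C} {n n' : Irr C → ℕ}
    (h : IsDecomposition x n) (h' : IsDecomposition x n') : n = n' :=
  funext fun z => (h.eq_finrank z).trans (h'.eq_finrank z).symm

/-- The multiplicity of the simple object `z` in `x`: the coefficient of `z` in the decomposition of
`x` into simple objects. -/
def multiplicity [IsFiniteSemisimple C] (x : C) (z : Irr C) : ℕ :=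
  (exists_isDecomposition x).choose z

theorem isDecomposition_multiplicity [IsFiniteSemisimple C] (x : C) :
    IsDecomposition x (multiplicity x) :=
  (exists_isDecomposition x).choose_spec

end Irr

section FPdim

variable {C : Type u} [Category.{v} C] [Preadditive C] [Linear ℂ C] [MonoidalCategory C]
  [IsFiniteSemisimple C]

/-- The matrix `N_x` of left multiplication by `x` in the basis of simple objects: its entry in row
`z` and column `y` is the number `N_{xy}^z` in `x ⊗ y ≃ ⨁_z N_{xy}^z · z`. -/
def fusionMatrix (x : C) : Matrix (Irr C) (Irr C) ℝ :=
  Matrix.of fun z y => (multiplicity (x ⊗ y.rep) z : ℝ)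

/-- The Frobenius–Perron dimension of `x`: the largest non-negative real eigenvalue of `N_x`.
The set of eigenvalues is finite, so the supremum is a maximum once there is a non-negative
eigenvalue; there always is one, by the Frobenius–Perron theorem. -/
def fpdim (x : C) : ℝ :=
  sSup {r : ℝ | 0 ≤ r ∧ Module.End.HasEigenvalue (Matrix.toLin' (fusionMatrix x)) r}

end FPdim

end FusionCat

end

/-! If `x` is invertible, `x ⊗ -` is an equivalence and preserves simples, so the columns of `N_x`
sum to 1. The all-ones vector is then a positive left eigenvector with eigenvalue 1, and a positive
left eigenvector of a nonnegative matrix belongs to its largest nonnegative eigenvalue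
(`isGreatest_eigenvalue_of_vecMul`).

Conversely, left and right multiplication commute, so the Perron vector of a positive symmetric
matrix built from right multiplications is an eigenvector of every `N_x`
(`exists_common_eigenvector`). Duality gives `N_{xL} = N_xᵀ`. If `FPdim(x) = 1`, both matrices fix a
positive vector, and integrality forces all row and column sums to be 1 (`row_sum_eq_one`). Hence `x
⊗ xL` and `xL ⊗ x` are simple, and the nonzero pairing morphisms are isomorphisms by Schur's lemma.
-/

namespace FusionCat

/-! ### Perron–Frobenius theory for real matrices. -/

section PerronFrobenius

open Matrix

variable {ι : Type*} [Fintype ι]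

/-- The quadratic form attains its maximum on the compact unit sphere; homogeneity extends the bound
to all vectors. -/
theorem exists_rayleigh_max [Nonempty ι] (M : Matrix ι ι ℝ) :
    ∃ (r : ℝ) (u : ι → ℝ), u ≠ 0 ∧ u ⬝ᵥ M *ᵥ u = r * (u ⬝ᵥ u) ∧
      ∀ w : ι → ℝ, w ⬝ᵥ M *ᵥ w ≤ r * (w ⬝ᵥ w) := by
  classical
  let S : Set (ι → ℝ) := {u | u ⬝ᵥ u = 1}
  have hclosed : IsClosed S :=
    isClosed_eq (by unfold dotProduct; fun_prop) continuous_const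
  have hbdd : Bornology.IsBounded S := by
    refine (Metric.isBounded_closedBall (x := (0 : ι → ℝ)) (r := 1)).subset fun u hu => ?_
    rw [mem_closedBall_zero_iff, pi_norm_le_iff_of_nonneg zero_le_one]
    intro i
    have h1 : u i * u i ≤ u ⬝ᵥ u :=
      Finset.single_le_sum (f := fun j => u j * u j) (fun j _ => mul_self_nonneg _)
        (Finset.mem_univ i)
    rw [Real.norm_eq_abs, ← abs_one, ← sq_le_sq]
    have hu' : u ⬝ᵥ u = 1 := hu
    nlinarith
  have hne : S.Nonempty := ⟨Pi.single (Classical.arbitrary ι) 1, by simp [S]⟩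
  have hcont : Continuous fun u : ι → ℝ => u ⬝ᵥ M *ᵥ u := by
    unfold mulVec dotProduct; fun_prop
  obtain ⟨u, hu, hmax⟩ :=
    (Metric.isCompact_of_isClosed_isBounded hclosed hbdd).exists_isMaxOn hne hcont.continuousOn
  have hu' : u ⬝ᵥ u = 1 := hu
  refine ⟨u ⬝ᵥ M *ᵥ u, u, ?_, by rw [hu', mul_one], fun w => ?_⟩
  · rintro rfl
    simp at hu'
  rcases eq_or_ne w 0 with rfl | hw
  · simp
  have hpos : 0 < w ⬝ᵥ w :=
    lt_of_le_of_ne (Finset.sum_nonneg fun i _ => mul_self_nonneg _)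
      fun h => hw (dotProduct_self_eq_zero.1 h.symm)
  set c := Real.sqrt (w ⬝ᵥ w)
  have hc : c * c = w ⬝ᵥ w := Real.mul_self_sqrt hpos.le
  have hc0 : c ≠ 0 := by
    rintro h
    rw [h] at hc
    linarith
  have hmem : c⁻¹ • w ∈ S := by
    change c⁻¹ • w ⬝ᵥ c⁻¹ • w = 1
    rw [smul_dotProduct, dotProduct_smul, ← hc]
    simp [hc0]
  have h2 : c⁻¹ • w ⬝ᵥ M *ᵥ (c⁻¹ • w) ≤ u ⬝ᵥ M *ᵥ u := hmax hmem
  have h3 : w ⬝ᵥ M *ᵥ w = (c * c) * (c⁻¹ • w ⬝ᵥ M *ᵥ (c⁻¹ • w)) := by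
    rw [mulVec_smul, smul_dotProduct, dotProduct_smul]
    simp only [smul_eq_mul]
    field_simp
  rw [h3, ← hc, mul_comm]
  exact mul_le_mul_of_nonneg_right h2 (mul_self_nonneg c)

/-- The Perron–Frobenius theorem for symmetric matrices with positive entries. -/
theorem exists_perron_vector [Nonempty ι] {M : Matrix ι ι ℝ} (hsymm : Mᵀ = M)
    (hpos : ∀ i j, 0 < M i j) :
    ∃ (r : ℝ) (v : ι → ℝ), (∀ i, 0 < v i) ∧ M *ᵥ v = r • v ∧
      ∀ u, M *ᵥ u = r • u → ∃ c : ℝ, u = c • v := by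
  classical
  obtain ⟨r, u₀, hu₀, heq, hle⟩ := exists_rayleigh_max M
  have hB : (r • (1 : Matrix ι ι ℝ) - M).PosSemidef := by
    refine .of_dotProduct_mulVec_nonneg ?_ fun w => ?_
    · simp [IsHermitian, conjTranspose_eq_transpose_of_trivial, hsymm]
    · simpa [sub_mulVec, smul_mulVec] using hle w
  -- A vector on which a positive semidefinite form vanishes lies in its kernel.
  have key : ∀ w : ι → ℝ, r * (w ⬝ᵥ w) ≤ w ⬝ᵥ M *ᵥ w → M *ᵥ w = r • w := fun w hw => by
    have h := (hB.dotProduct_mulVec_zero_iff w).1 (by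
      simpa [sub_mulVec, smul_mulVec, sub_eq_zero] using le_antisymm hw (hle w))
    simpa [sub_mulVec, smul_mulVec, sub_eq_zero, eq_comm] using h
  -- Positivity of `M` makes `|w|` a maximizer too, and `M|w|` has no zero entry.
  have habs : ∀ w : ι → ℝ, w ≠ 0 → r * (w ⬝ᵥ w) ≤ w ⬝ᵥ M *ᵥ w →
      M *ᵥ (fun i => |w i|) = r • (fun i => |w i|) ∧ ∀ i, 0 < |w i| := by
    intro w hw0 hw
    have h1 : M *ᵥ (fun i => |w i|) = r • (fun i => |w i|) := by
      apply key
      calc r * ((fun i => |w i|) ⬝ᵥ fun i => |w i|) = r * (w ⬝ᵥ w) := by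
            simp [dotProduct]
        _ ≤ w ⬝ᵥ M *ᵥ w := hw
        _ ≤ (fun i => |w i|) ⬝ᵥ M *ᵥ (fun i => |w i|) := by
            simp only [dotProduct, mulVec, Finset.mul_sum]
            refine Finset.sum_le_sum fun i _ => Finset.sum_le_sum fun j _ => ?_
            refine (le_abs_self _).trans (le_of_eq ?_)
            rw [abs_mul, abs_mul, abs_of_pos (hpos i j)]
    refine ⟨h1, fun i => ?_⟩
    obtain ⟨j, hj⟩ := Function.ne_iff.1 hw0
    have h2 : 0 < (M *ᵥ (fun i => |w i|)) i :=
      Finset.sum_pos' (fun k _ => mul_nonneg (hpos i k).le (abs_nonneg _))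
        ⟨j, Finset.mem_univ j, mul_pos (hpos i j) (abs_pos.2 hj)⟩
    rw [h1] at h2
    refine lt_of_le_of_ne (abs_nonneg _) fun h => ?_
    simp [← h] at h2
  obtain ⟨hv, hvpos⟩ := habs u₀ hu₀ heq.ge
  refine ⟨r, _, hvpos, hv, fun u hu => ?_⟩
  obtain ⟨i⟩ := ‹Nonempty ι›
  -- This scalar makes `u - c • v` vanish at `i`, which `habs` forbids for a nonzero eigenvector.
  refine ⟨u i / |u₀ i|, ?_⟩
  by_contra hne
  refine ((habs _ (sub_ne_zero.2 hne) (le_of_eq ?_)).2 i).ne' ?_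
  · rw [mulVec_sub, mulVec_smul, hu, hv, smul_comm (u i / |u₀ i|), ← smul_sub, dotProduct_smul,
      smul_eq_mul]
  · simp [div_mul_cancel₀ _ (hvpos i).ne']

/-- For a nonnegative matrix with a positive left eigenvector, the corresponding eigenvalue is the
largest nonnegative eigenvalue. -/
theorem isGreatest_eigenvalue_of_vecMul [Nonempty ι] [DecidableEq ι] {N : Matrix ι ι ℝ}
    (hN : ∀ i j, 0 ≤ N i j) {v : ι → ℝ} (hv : ∀ i, 0 < v i) {r : ℝ} (h : v ᵥ* N = r • v) :
    IsGreatest {a : ℝ | 0 ≤ a ∧ Module.End.HasEigenvalue (toLin' N) a} r := by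
  have hv0 : v ≠ 0 := fun h0 => (hv (Classical.arbitrary ι)).ne' (congrFun h0 _)
  refine ⟨⟨?_, ?_⟩, ?_⟩
  · have i := Classical.arbitrary ι
    have h1 : 0 ≤ (v ᵥ* N) i := Finset.sum_nonneg fun j _ => mul_nonneg (hv j).le (hN j i)
    rw [h] at h1
    exact nonneg_of_mul_nonneg_left h1 (hv i)
  · have hdet : (N - r • (1 : Matrix ι ι ℝ)).det = 0 := by
      refine exists_vecMul_eq_zero_iff.1 ⟨v, hv0, ?_⟩
      rw [vecMul_sub, h, vecMul_smul, vecMul_one, sub_self]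
    obtain ⟨u, hu0, hu⟩ := exists_mulVec_eq_zero_iff.2 hdet
    refine Module.End.hasEigenvalue_of_hasEigenvector (x := u)
      ⟨Module.End.mem_eigenspace_iff.2 ?_, hu0⟩
    simpa [sub_mulVec, smul_mulVec, sub_eq_zero] using hu
  · rintro a ⟨ha, hae⟩
    obtain ⟨u, hu⟩ := hae.exists_hasEigenvector
    have hue : N *ᵥ u = a • u := by simpa using hu.apply_eq_smul
    obtain ⟨j, hj⟩ := Function.ne_iff.1 hu.2
    have hpos : 0 < ∑ i, v i * |u i| :=
      Finset.sum_pos' (fun k _ => mul_nonneg (hv k).le (abs_nonneg _))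
        ⟨j, Finset.mem_univ j, mul_pos (hv j) (abs_pos.2 hj)⟩
    refine le_of_mul_le_mul_right ?_ hpos
    -- Pairing with the positive left eigenvector turns `a|u| ≤ N|u|` into `a ≤ r`.
    calc a * ∑ i, v i * |u i| = ∑ i, v i * |(N *ᵥ u) i| := by
          rw [hue, Finset.mul_sum]
          refine Finset.sum_congr rfl fun i _ => ?_
          rw [Pi.smul_apply, smul_eq_mul, abs_mul, abs_of_nonneg ha]
          ring
      _ ≤ ∑ i, v i * ∑ j, N i j * |u j| := by
          refine Finset.sum_le_sum fun i _ => mul_le_mul_of_nonneg_left ?_ (hv i).le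
          refine (Finset.abs_sum_le_sum_abs _ _).trans (le_of_eq ?_)
          exact Finset.sum_congr rfl fun j _ => by rw [abs_mul, abs_of_nonneg (hN i j)]
      _ = (v ᵥ* N) ⬝ᵥ fun j => |u j| := dotProduct_mulVec v N fun j => |u j|
      _ = r * ∑ i, v i * |u i| := by
          rw [h, smul_dotProduct]
          rfl

/-- A matrix of natural numbers fixing a positive vector, whose transpose fixes it as well, has row
sums `1`. -/
theorem row_sum_eq_one {N : Matrix ι ι ℕ} {v : ι → ℝ} (hv : ∀ i, 0 < v i)
    (h₁ : N.map (Nat.cast : ℕ → ℝ) *ᵥ v = v) (h₂ : v ᵥ* N.map (Nat.cast : ℕ → ℝ) = v) (i : ι) :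
    ∑ j, N i j = 1 := by
  have hrow : ∀ k, ∑ j, (N k j : ℝ) * v j = v k := fun k => congrFun h₁ k
  have hcol : ∀ j, ∑ k, v k * (N k j : ℝ) = v j := fun j => congrFun h₂ j
  have hle : ∀ j, v i * N i j ≤ v j := fun j => by
    rw [← hcol j]
    exact Finset.single_le_sum (f := fun k => v k * (N k j : ℝ))
      (fun k _ => mul_nonneg (hv k).le (Nat.cast_nonneg _)) (Finset.mem_univ i)
  apply le_antisymm
  · have h : (∑ j, (N i j : ℝ)) * v i ≤ 1 * v i := by
      rw [one_mul, Finset.sum_mul]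
      refine (Finset.sum_le_sum fun j _ => ?_).trans (hrow i).le
      -- Integrality enters here: `n ≤ n²` holds for natural numbers.
      have h1 : (N i j : ℝ) ≤ N i j * N i j := by exact_mod_cast Nat.le_mul_self _
      calc (N i j : ℝ) * v i ≤ (N i j * N i j) * v i := mul_le_mul_of_nonneg_right h1 (hv i).le
        _ = N i j * (v i * N i j) := by ring
        _ ≤ N i j * v j := mul_le_mul_of_nonneg_left (hle j) (Nat.cast_nonneg _)
    exact_mod_cast le_of_mul_le_mul_right h (hv i)
  · by_contra! h0
    have h1 : ∀ j, N i j = 0 := by simpa using h0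
    have := hrow i
    simp only [h1, Nat.cast_zero, zero_mul, Finset.sum_const_zero] at this
    exact (hv i).ne this

end PerronFrobenius

universe v u

/-! ### Multiplicities, Schur's lemma and matrices of functors. -/

section Semisimple

variable {C : Type u} [Category.{v} C] [Preadditive C] [Linear ℂ C]

theorem IsSimple.of_iso {a b : C} (ha : IsSimple a) (e : a ≅ b) : IsSimple b := by
  obtain ⟨E⟩ := ha
  exact ⟨((Linear.homCongr ℂ e e).symm).trans E⟩

/-- Morphisms out of a direct sum are families of morphisms out of the summands. -/
noncomputable def biproductHomEquiv [HasFiniteBiproducts C] {J : Type*} [Fintype J] (f : J → C)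
    (t : C) : (⨁ f ⟶ t) ≃ₗ[ℂ] (∀ j, f j ⟶ t) where
  toFun g j := biproduct.ι f j ≫ g
  invFun g := biproduct.desc g
  map_add' g h := by ext j; simp
  map_smul' c g := by ext j; simp
  left_inv g := by ext j; simp
  right_inv g := by ext j; simp

variable [IsFiniteSemisimple C]

instance finiteDimensional_hom (x y : C) : FiniteDimensional ℂ (x ⟶ y) :=
  IsFiniteSemisimple.finiteDimensional_hom x y

theorem multiplicity_eq_finrank (x : C) (z : Irr C) :
    multiplicity x z = Module.finrank ℂ (x ⟶ z.rep) :=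
  (isDecomposition_multiplicity x).eq_finrank z

theorem multiplicity_congr {x y : C} (e : x ≅ y) : multiplicity x = multiplicity y :=
  funext fun z => by
    rw [multiplicity_eq_finrank, multiplicity_eq_finrank,
      (Linear.homCongr ℂ e (Iso.refl z.rep)).finrank_eq]

theorem finrank_hom_of_iso_biproduct {J : Type*} [Fintype J] {f : J → C} {a : C} (e : a ≅ ⨁ f)
    (t : C) : Module.finrank ℂ (a ⟶ t) = ∑ j, Module.finrank ℂ (f j ⟶ t) := by
  rw [((Linear.homCongr ℂ e (Iso.refl t)).trans (biproductHomEquiv f t)).finrank_eq,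
    Module.finrank_pi_fintype]

theorem finrank_hom_eq_sum (a t : C) :
    Module.finrank ℂ (a ⟶ t) = ∑ z, multiplicity a z * Module.finrank ℂ (z.rep ⟶ t) := by
  obtain ⟨e⟩ := isDecomposition_multiplicity a
  rw [finrank_hom_of_iso_biproduct e, Fintype.sum_sigma]
  refine Finset.sum_congr rfl fun z _ => ?_
  change ∑ _ : Fin (multiplicity a z), Module.finrank ℂ (z.rep ⟶ t) = _
  simp

theorem multiplicity_rep (z w : Irr C) : multiplicity z.rep w = if z = w then 1 else 0 := by
  rw [multiplicity_eq_finrank]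
  split_ifs with h
  · subst h
    obtain ⟨E⟩ := z.isSimple_rep
    rw [E.finrank_eq, Module.finrank_self]
  · have : Subsingleton (z.rep ⟶ w.rep) :=
      ⟨fun f g => by rw [Irr.areDisjoint h f, Irr.areDisjoint h g]⟩
    exact Module.finrank_zero_of_subsingleton

theorem finrank_rep_hom (z : Irr C) (b : C) :
    Module.finrank ℂ (z.rep ⟶ b) = multiplicity b z := by
  obtain ⟨e⟩ := isDecomposition_multiplicity b
  let f := fun p : (Σ z : Irr C, Fin (multiplicity b z)) => p.1.rep
  let L : (z.rep ⟶ b) ≃ₗ[ℂ] (∀ p, z.rep ⟶ f p) :=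
    { toFun := fun g p => g ≫ e.hom ≫ biproduct.π f p
      invFun := fun g => biproduct.lift g ≫ e.inv
      map_add' := fun g h => by ext p; simp
      map_smul' := fun c g => by ext p; simp
      left_inv := fun g => by
        rw [← cancel_mono e.hom]
        ext p
        simp [f]
      right_inv := fun g => by ext p; simp }
  rw [L.finrank_eq, Module.finrank_pi_fintype, Fintype.sum_sigma]
  simp [f, ← multiplicity_eq_finrank, multiplicity_rep]

theorem finrank_hom_eq_sum_mul (a b : C) :
    Module.finrank ℂ (a ⟶ b) = ∑ z, multiplicity a z * multiplicity b z := by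
  rw [finrank_hom_eq_sum]
  simp only [finrank_rep_hom]

/-- This symmetry is what turns adjunctions into matrix transposes. -/
theorem finrank_hom_comm (a b : C) : Module.finrank ℂ (a ⟶ b) = Module.finrank ℂ (b ⟶ a) := by
  simp only [finrank_hom_eq_sum_mul, mul_comm]

theorem isSimple_iff_finrank (a : C) : IsSimple a ↔ Module.finrank ℂ (a ⟶ a) = 1 :=
  ⟨fun ⟨E⟩ => by rw [E.finrank_eq, Module.finrank_self],
    fun h => ⟨LinearEquiv.ofFinrankEq _ _ (by rw [h, Module.finrank_self])⟩⟩

theorem isSimple_iff_sum_multiplicity (a : C) : IsSimple a ↔ ∑ z, multiplicity a z = 1 := by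
  constructor
  · intro h
    have e := (Irr.rep_mk_iso a h).some
    simp [multiplicity_congr e.symm, multiplicity_rep]
  · intro h
    rw [isSimple_iff_finrank, finrank_hom_eq_sum_mul, ← h]
    -- Multiplicities with sum 1 are 0 or 1, hence equal to their squares.
    refine Finset.sum_congr rfl fun z _ => ?_
    have hle : multiplicity a z ≤ 1 :=
      h ▸ Finset.single_le_sum (f := multiplicity a) (fun _ _ => Nat.zero_le _)
        (Finset.mem_univ z)
    interval_cases multiplicity a z <;> rfl

theorem id_eq_zero_of_multiplicity {a : C} (h : ∀ z, multiplicity a z = 0) : 𝟙 a = 0 := by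
  have h0 : Module.finrank ℂ (a ⟶ a) = 0 := by simp [finrank_hom_eq_sum_mul, h]
  have := Module.finrank_zero_iff.1 h0
  exact Subsingleton.elim _ _

/-- Schur's lemma. -/
theorem IsSimple.isIso_of_ne_zero {a b : C} (ha : IsSimple a) (hb : IsSimple b) {f : a ⟶ b}
    (hf : f ≠ 0) : IsIso f := by
  obtain ⟨i⟩ := Irr.rep_mk_iso a ha
  obtain ⟨j⟩ := Irr.rep_mk_iso b hb
  generalize Irr.mk a ha = z at i
  generalize Irr.mk b hb = w at j
  have hg : i.hom ≫ f ≫ j.inv ≠ 0 := fun h => hf <| by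
    rw [← cancel_epi i.hom, ← cancel_mono j.inv, Category.assoc, h]
    simp
  have hzw : z = w := by
    by_contra hne
    exact hg (Irr.areDisjoint hne _)
  subst hzw
  obtain ⟨c, hc⟩ := z.isSimple_rep.exists_smul (i.hom ≫ f ≫ j.inv)
  have hc0 : c ≠ 0 := by
    rintro rfl
    exact hg (by simpa using hc)
  have hiso : IsIso (i.hom ≫ f ≫ j.inv) := by
    rw [hc]
    exact ⟨c⁻¹ • 𝟙 _, by simp [smul_smul, hc0], by simp [smul_smul, hc0]⟩
  have : f = i.inv ≫ (i.hom ≫ f ≫ j.inv) ≫ j.hom := by simp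
  rw [this]
  infer_instance

theorem IsSimple.exists_retraction {s a : C} (hs : IsSimple s) {f : s ⟶ a} (hf : f ≠ 0) :
    ∃ p : a ⟶ s, f ≫ p = 𝟙 s := by
  obtain ⟨e⟩ := isDecomposition_multiplicity a
  let g := fun p : (Σ z : Irr C, Fin (multiplicity a z)) => p.1.rep
  have h : ∃ l, f ≫ e.hom ≫ biproduct.π g l ≠ 0 := by
    by_contra! h
    apply hf
    rw [← cancel_mono e.hom]
    ext l
    simpa using h l
  obtain ⟨l, hl⟩ := h
  have := hs.isIso_of_ne_zero l.1.isSimple_rep hl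
  exact ⟨(e.hom ≫ biproduct.π g l) ≫ inv (f ≫ e.hom ≫ biproduct.π g l), by
    rw [← Category.assoc, IsIso.hom_inv_id]⟩

/-- The matrix of multiplicities of the simple objects in the images of the simple objects. -/
noncomputable def functorMatrix (F : C ⥤ C) : Matrix (Irr C) (Irr C) ℕ :=
  Matrix.of fun z y => multiplicity (F.obj y.rep) z

/-- Additive functors preserve finite direct sums, so they act linearly on multiplicity vectors. -/
theorem multiplicity_obj (F : C ⥤ C) [F.Additive] (a : C) (z : Irr C) :
    multiplicity (F.obj a) z = ∑ y, functorMatrix F z y * multiplicity a y := by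
  obtain ⟨e⟩ := isDecomposition_multiplicity a
  let ε := (Fintype.equivFin (Σ y : Irr C, Fin (multiplicity a y))).symm
  let i : (⨁ fun k => (ε k).1.rep) ≅ ⨁ fun p : (Σ y : Irr C, Fin (multiplicity a y)) => p.1.rep :=
    biproduct.whiskerEquiv (g := fun p => p.1.rep) ε fun k => Iso.refl (ε k).1.rep
  let E := F.mapIso (e ≪≫ i.symm) ≪≫ F.mapBiproduct _
  rw [multiplicity_eq_finrank, finrank_hom_of_iso_biproduct E]
  refine (ε.sum_comp fun p => Module.finrank ℂ (F.obj p.1.rep ⟶ z.rep)).trans ?_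
  rw [Fintype.sum_sigma]
  refine Finset.sum_congr rfl fun y _ => ?_
  change ∑ _ : Fin (multiplicity a y), Module.finrank ℂ (F.obj y.rep ⟶ z.rep) = _
  simp [functorMatrix, multiplicity_eq_finrank, mul_comm]

theorem functorMatrix_comp (G F : C ⥤ C) [F.Additive] :
    functorMatrix (G ⋙ F) = functorMatrix F * functorMatrix G := by
  ext z y
  exact multiplicity_obj F (G.obj y.rep) z

theorem functorMatrix_congr {F G : C ⥤ C} (e : F ≅ G) : functorMatrix F = functorMatrix G := by
  ext z y
  exact congrFun (multiplicity_congr (e.app y.rep)) z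

theorem functorMatrix_transpose_of_adjunction {F G : C ⥤ C} [G.Additive] [G.Linear ℂ]
    (adj : F ⊣ G) : (functorMatrix G).transpose = functorMatrix F := by
  ext z y
  let L : (F.obj y.rep ⟶ z.rep) ≃ₗ[ℂ] (y.rep ⟶ G.obj z.rep) :=
    { adj.homEquiv y.rep z.rep with
      map_add' := fun f g => by simp [adj.homEquiv_unit]
      map_smul' := fun c f => by simp [adj.homEquiv_unit] }
  calc multiplicity (G.obj z.rep) y = Module.finrank ℂ (G.obj z.rep ⟶ y.rep) :=
        multiplicity_eq_finrank _ _
    _ = Module.finrank ℂ (F.obj y.rep ⟶ z.rep) := by rw [finrank_hom_comm, L.finrank_eq]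
    _ = multiplicity (F.obj y.rep) z := (multiplicity_eq_finrank _ _).symm

end Semisimple

/-! ### Dual pairings and invertible objects. -/

section Pairing

variable {C : Type u} [Category.{v} C] [Preadditive C] [MonoidalCategory C]
  [MonoidalPreadditive C]

/-- By a zigzag identity, `𝟙 x` factors through the coevaluation up to coherence. -/
theorem coevaluation_ne_zero {x y : C} [ExactPairing x y] (hx : 𝟙 x ≠ 0) : η_ x y ≠ 0 := by
  intro h
  have h1 := ExactPairing.evaluation_coevaluation x y
  rw [h, MonoidalPreadditive.zero_whiskerRight, zero_comp] at h1
  apply hx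
  rw [← cancel_epi (λ_ x).hom, ← cancel_mono (ρ_ x).inv]
  simpa using h1.symm

theorem evaluation_ne_zero {x y : C} [ExactPairing x y] (hx : 𝟙 x ≠ 0) : ε_ x y ≠ 0 := by
  intro h
  have h1 := ExactPairing.evaluation_coevaluation x y
  rw [h, MonoidalPreadditive.whiskerLeft_zero, comp_zero, comp_zero] at h1
  apply hx
  rw [← cancel_epi (λ_ x).hom, ← cancel_mono (ρ_ x).inv]
  simpa using h1.symm

theorem id_ne_zero_left_of_pairing {x y : C} [ExactPairing x y] (hy : 𝟙 y ≠ 0) : 𝟙 x ≠ 0 := by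
  intro h
  have h0 : η_ x y = 0 := by
    rw [← Category.comp_id (η_ x y), ← MonoidalCategory.id_whiskerRight, h,
      MonoidalPreadditive.zero_whiskerRight, comp_zero]
  have h1 := ExactPairing.coevaluation_evaluation x y
  rw [h0, MonoidalPreadditive.whiskerLeft_zero, zero_comp] at h1
  apply hy
  rw [← cancel_epi (ρ_ y).hom, ← cancel_mono (λ_ y).inv]
  simpa using h1.symm

/-- Tensoring on the left with an invertible object is an equivalence. -/
theorem isEquivalence_tensorLeft {C : Type u} [Category.{v} C] [MonoidalCategory C] {x y : C}
    (e : x ⊗ y ≅ 𝟙_ C) (f : 𝟙_ C ≅ y ⊗ x) : (tensorLeft x).IsEquivalence :=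
  (CategoryTheory.Equivalence.mk (tensorLeft x) (tensorLeft y)
    (((leftUnitorNatIso C).symm ≪≫ (tensoringLeft C).mapIso f ≪≫ tensorLeftTensor y x))
    ((tensorLeftTensor x y).symm ≪≫ (tensoringLeft C).mapIso e ≪≫
      leftUnitorNatIso C)).isEquivalence_functor

end Pairing

/-! ### Fusion matrices and the Frobenius–Perron dimension. -/

section Fusion

variable {C : Type u} [Category.{v} C] [Preadditive C] [Linear ℂ C] [MonoidalCategory C]
  [MonoidalPreadditive C] [MonoidalLinear ℂ C] [RigidCategory C] [IsFusion C]

instance nonempty_irr : Nonempty (Irr C) := ⟨Irr.mk (𝟙_ C) IsFusion.isSimple_unit⟩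

/-- The unit is a retract of `b ⊗ bᘁ`, so `a` is a retract of `a ⊗ (b ⊗ bᘁ)`, which would vanish
with `a ⊗ b`. -/
theorem id_tensor_ne_zero {a b : C} (ha : 𝟙 a ≠ 0) (hb : 𝟙 b ≠ 0) : 𝟙 (a ⊗ b) ≠ 0 := by
  intro h
  obtain ⟨p, hp⟩ := (IsFusion.isSimple_unit (C := C)).exists_retraction
    (coevaluation_ne_zero (y := bᘁ) hb)
  have h0 : 𝟙 (a ⊗ (b ⊗ bᘁ)) = 0 := by
    rw [← cancel_epi (α_ a b bᘁ).hom, Category.comp_id, ← Category.id_comp (α_ a b bᘁ).hom,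
      ← MonoidalCategory.id_whiskerRight, h, MonoidalPreadditive.zero_whiskerRight, zero_comp,
      comp_zero]
  apply ha
  have h1 : 𝟙 (a ⊗ 𝟙_ C) = 0 := by
    rw [← MonoidalCategory.whiskerLeft_id, ← hp, MonoidalCategory.whiskerLeft_comp,
      ← Category.id_comp (a ◁ p), h0, zero_comp, comp_zero]
  rw [← cancel_epi (ρ_ a).hom, Category.comp_id, ← Category.id_comp (ρ_ a).hom, h1, zero_comp,
    comp_zero]

/-- Every simple object occurs in the product of a given simple object with some simple object. -/
theorem exists_tensorRight_matrix_pos (t s : Irr C) :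
    ∃ w : Irr C, 0 < functorMatrix (tensorRight w.rep) t s := by
  by_contra! h
  have hs := s.isSimple_rep.id_ne_zero
  -- By duality, `w` occurs in `ᘁs ⊗ t` as often as `t` in `s ⊗ w`; were this always 0, `ᘁs ⊗ t`
  -- would be zero.
  refine id_tensor_ne_zero (id_ne_zero_left_of_pairing (x := ᘁs.rep) hs)
    t.isSimple_rep.id_ne_zero (id_eq_zero_of_multiplicity fun w => ?_)
  have hT := congrFun (congrFun (functorMatrix_transpose_of_adjunction
    (tensorLeftAdjunction (ᘁs.rep) s.rep)) t) w
  exact hT.trans (Nat.le_zero.1 (h w))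

theorem tensorRight_matrix_transpose (w : C) :
    (functorMatrix (tensorRight w)).transpose = functorMatrix (tensorRight (ᘁw)) :=
  functorMatrix_transpose_of_adjunction (tensorRightAdjunction (ᘁw) w)

/-- This is the associator. -/
theorem commute_tensorLeft_tensorRight (x w : C) :
    Commute (functorMatrix (tensorLeft x)) (functorMatrix (tensorRight w)) := by
  rw [Commute, SemiconjBy, ← functorMatrix_comp, ← functorMatrix_comp]
  exact functorMatrix_congr (NatIso.ofComponents (fun y => (α_ x y w).symm))

theorem fusionMatrix_eq_map (x : C) :
    fusionMatrix x = (functorMatrix (tensorLeft x)).map (Nat.cast : ℕ → ℝ) := rfl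

theorem fusionMatrix_transpose (x xL : C) [ExactPairing x xL] :
    (fusionMatrix x).transpose = fusionMatrix xL := by
  rw [fusionMatrix_eq_map, fusionMatrix_eq_map, ← Matrix.transpose_map,
    functorMatrix_transpose_of_adjunction (tensorLeftAdjunction x xL)]

open Matrix in
/-- The fusion matrices have a common positive eigenvector. -/
theorem exists_common_eigenvector : ∃ v : Irr C → ℝ, (∀ z, 0 < v z) ∧
    ∀ x : C, ∃ r : ℝ, fusionMatrix x *ᵥ v = r • v := by
  -- Summing over all `w` gives positivity, and adding transposes gives symmetry; each transpose is
  -- again a right multiplication, by `ᘁw`.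
  let R : Matrix (Irr C) (Irr C) ℕ :=
    ∑ w : Irr C, (functorMatrix (tensorRight w.rep) + (functorMatrix (tensorRight w.rep))ᵀ)
  let M : Matrix (Irr C) (Irr C) ℝ := (Nat.castRingHom ℝ).mapMatrix R
  have hR : Rᵀ = R := by simp [R, transpose_sum, add_comm]
  have hsymm : Mᵀ = M := by
    change (R.map _)ᵀ = R.map _
    rw [← transpose_map, hR]
  have hpos : ∀ t s, 0 < M t s := fun t s => by
    obtain ⟨w, hw⟩ := exists_tensorRight_matrix_pos t s
    have : 0 < R t s := by
      simp only [R, Matrix.sum_apply]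
      exact Finset.sum_pos' (fun _ _ => Nat.zero_le _)
        ⟨w, Finset.mem_univ w, Nat.add_pos_left hw _⟩
    simpa [M] using this
  obtain ⟨r, v, hv, hMv, huniq⟩ := exists_perron_vector hsymm hpos
  -- Commuting with `M`, the fusion matrix preserves the line spanned by `v`.
  refine ⟨v, hv, fun x => huniq _ ?_⟩
  have hc : Commute (functorMatrix (tensorLeft x)) R := by
    refine Commute.sum_right _ _ _ fun w _ => Commute.add_right
      (commute_tensorLeft_tensorRight x w.rep) ?_
    rw [tensorRight_matrix_transpose]
    exact commute_tensorLeft_tensorRight x _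
  have hc' : fusionMatrix x * M = M * fusionMatrix x := hc.map (Nat.castRingHom ℝ).mapMatrix
  rw [mulVec_mulVec, ← hc', ← mulVec_mulVec, hMv, mulVec_smul]

theorem fusionMatrix_nonneg (x : C) (z y : Irr C) : 0 ≤ fusionMatrix x z y :=
  Nat.cast_nonneg _

open Matrix in
theorem fpdim_eq_of_vecMul {x : C} {v : Irr C → ℝ} (hv : ∀ z, 0 < v z) {r : ℝ}
    (h : v ᵥ* fusionMatrix x = r • v) : fpdim x = r :=
  (isGreatest_eigenvalue_of_vecMul (fusionMatrix_nonneg x) hv h).csSup_eq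

open Matrix in
/-- A common positive eigenvector of the fusion matrix and its transpose, with eigenvalue the
Frobenius–Perron dimension. -/
theorem exists_fpdim_eigenvector (x xL : C) [ExactPairing x xL] :
    ∃ v : Irr C → ℝ, (∀ z, 0 < v z) ∧ fusionMatrix x *ᵥ v = fpdim x • v ∧
      v ᵥ* fusionMatrix x = fpdim x • v := by
  obtain ⟨v, hv, h⟩ := exists_common_eigenvector (C := C)
  obtain ⟨r, hr⟩ := h x
  obtain ⟨r', hr'⟩ := h xL
  rw [← fusionMatrix_transpose x xL, mulVec_transpose] at hr'
  have hvv : v ⬝ᵥ v ≠ 0 :=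
    (Finset.sum_pos (fun z _ => mul_pos (hv z) (hv z)) Finset.univ_nonempty).ne'
  -- Both eigenvalues are read off from `v ⬝ᵥ N_x v`.
  have hrr : r = r' := by
    have h1 := dotProduct_mulVec v (fusionMatrix x) v
    rw [hr, hr', dotProduct_smul, smul_dotProduct] at h1
    exact mul_right_cancel₀ hvv h1
  subst hrr
  rw [fpdim_eq_of_vecMul hv hr']
  exact ⟨v, hv, hr, hr'⟩

theorem fpdim_eq_one_of_isSimple_tensor {x : C} (h : ∀ s : C, IsSimple s → IsSimple (x ⊗ s)) :
    fpdim x = 1 := by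
  refine fpdim_eq_of_vecMul (v := fun _ => 1) (fun _ => one_pos) (funext fun y => ?_)
  have h1 := (isSimple_iff_sum_multiplicity _).1 (h y.rep y.isSimple_rep)
  have h2 : ∑ z, (1 : ℝ) * fusionMatrix x z y = 1 := by
    simp only [one_mul, fusionMatrix, Matrix.of_apply]
    exact_mod_cast h1
  exact h2.trans (by simp)

theorem isSimple_tensor_of_col_sum {x s : C} (hs : IsSimple s)
    (h : ∀ y, ∑ z, functorMatrix (tensorLeft x) z y = 1) : IsSimple (x ⊗ s) :=
  ((isSimple_iff_sum_multiplicity (x ⊗ (Irr.mk s hs).rep)).2 (h _)).of_iso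
    (whiskerLeftIso x (Irr.rep_mk_iso s hs).some)

theorem isIso_pairing_of_fpdim_eq_one {x xL : C} [ExactPairing x xL] (h : fpdim x = 1) :
    IsIso (η_ x xL) ∧ IsIso (ε_ x xL) := by
  obtain ⟨v, hv, h1, h2⟩ := exists_fpdim_eigenvector x xL
  rw [h, one_smul, fusionMatrix_eq_map] at h1 h2
  have hT := functorMatrix_transpose_of_adjunction (tensorLeftAdjunction x xL)
  have hxL : ∀ s, IsSimple s → IsSimple (xL ⊗ s) := fun s hs =>
    isSimple_tensor_of_col_sum hs fun y => by
      rw [← hT]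
      exact row_sum_eq_one hv h1 h2 y
  have hx : ∀ s, IsSimple s → IsSimple (x ⊗ s) := fun s hs =>
    isSimple_tensor_of_col_sum hs fun y =>
      row_sum_eq_one (N := (functorMatrix (tensorLeft x)).transpose) hv
        (by rw [Matrix.transpose_map, Matrix.mulVec_transpose, h2])
        (by rw [Matrix.transpose_map, Matrix.vecMul_transpose, h1]) y
  have h1s : IsSimple (𝟙_ C) := IsFusion.isSimple_unit
  have hxs : IsSimple x := (hx _ h1s).of_iso (ρ_ x)
  have hxLs : IsSimple xL := (hxL _ h1s).of_iso (ρ_ xL)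
  exact ⟨h1s.isIso_of_ne_zero (hx _ hxLs) (coevaluation_ne_zero hxs.id_ne_zero),
    (hxL _ hxs).isIso_of_ne_zero h1s (evaluation_ne_zero hxs.id_ne_zero)⟩

theorem fpdim_eq_one_of_invertible {x y : C} (e : x ⊗ y ≅ 𝟙_ C) (f : 𝟙_ C ≅ y ⊗ x) :
    fpdim x = 1 := by
  have := isEquivalence_tensorLeft e f
  refine fpdim_eq_one_of_isSimple_tensor fun s ⟨E⟩ => ?_
  -- Full faithfulness of `x ⊗ -` identifies the endomorphism spaces, so simplicity is preserved.
  let L : (s ⟶ s) ≃ₗ[ℂ] (x ⊗ s ⟶ x ⊗ s) :=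
    LinearEquiv.ofBijective ((tensorLeft x).mapLinearMap ℂ)
      ⟨(tensorLeft x).map_injective, (tensorLeft x).map_surjective⟩
  exact ⟨L.symm.trans E⟩

end Fusion

end FusionCat

theorem mainTheorem1 {C : Type*} [Category* C] [Preadditive C] [Linear ℂ C]
    [MonoidalCategory C] [MonoidalPreadditive C] [MonoidalLinear ℂ C] [RigidCategory C]
    [FusionCat.IsFusion C] (x xL : C) [ExactPairing x xL] :
    List.TFAE [
      IsIso (ExactPairing.coevaluation x xL) ∧ IsIso (ExactPairing.evaluation x xL),
      ∃ y : C, Nonempty (x ⊗ y ≅ 𝟙_ C) ∧ Nonempty (𝟙_ C ≅ y ⊗ x),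
      FusionCat.fpdim x = 1] := by
  tfae_have 1 → 2 := fun ⟨_, _⟩ =>
    ⟨xL, ⟨(asIso (ExactPairing.coevaluation x xL)).symm⟩,
      ⟨(asIso (ExactPairing.evaluation x xL)).symm⟩⟩
  tfae_have 2 → 3 := fun ⟨_, ⟨e⟩, ⟨f⟩⟩ => FusionCat.fpdim_eq_one_of_invertible e f
  tfae_have 3 → 1 := FusionCat.isIso_pairing_of_fpdim_eq_one
  tfae_finish
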